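/- Let $(X,\mathcal{B})$ be a $5$-$(24,8,1)$ design (the large Witt design, which is unique up to isomorphism): $X$ is a set of $24$ points and $\mathcal{B}$ is a set of $8$-element subsets of $X$, called blocks, such that every $5$-element subset of $X$ is contained in exactly one block. For $B\subseteq X$ let $\mathbf{c}_B\in\{0,1\}^X\subseteq\mathbb{C}^X$ be its characteristic vector, and write $\mathbf{c}_B\cdot\mathbf{x}=\sum_{h\in B}x_h$. In the polynomial ring $\mathcal{R}=\mathbb{C}[x_h : h\in X]$ let $\mathcal{I}(\mathcal{B})$ be the ideal of all polynomials vanishing at $\mathbf{c}_B$ for every $B\in\mathcal{B}$, let $$\mathcal{G}_0=\Big\{\sum_{h\in X}x_h-8\Big\}\cup\{x_h^2-x_h : h\in X\},$$ and let $\mathcal{T}=\langle\mathcal{G}_0\rangle$. Define $$\gamma_1(\mathcal{B})=\min\{\deg f : f\in\mathcal{I}(\mathcal{B}),\ f\notin\mathcal{T}\},$$ $$\gamma_2(\mathcal{B})=\min\big\{\max\{\deg f : f\in\mathcal{G}\} : \mathcal{G}\subseteq\mathcal{R},\ \langle\mathcal{G}\rangle=\mathcal{I}(\mathcal{B})\big\}.$$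 For a block $B\in\mathcal{B}$ and points $i,j\in B$ put $$f_{B,i,j}(\mathbf{x})=(x_i-x_j)(\mathbf{c}_B\cdot\mathbf{x}-2)(\mathbf{c}_B\cdot\mathbf{x}-4).$$ Then (i) $\mathcal{I}(\mathcal{B})$ is generated by $\mathcal{G}_0\cup\{f_{B,i,j} : B\in\mathcal{B},\ i,j\in B\}$; (ii) $\gamma_1(\mathcal{B})=\gamma_2(\mathcal{B})=3$. -/

import Mathlib

noncomputable section

namespace DesignIdeal

/-- `(V, 𝓑)` is a `t`-`(v, k, l)` design: `V` has `v` points, every block has `k` points, and every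
`t`-element set of points lies in exactly `l` blocks. -/
structure IsDesign {V : Type*} [Fintype V] [DecidableEq V]
    (t v k l : ℕ) (𝓑 : Finset (Finset V)) : Prop where
  card_points : Fintype.card V = v
  card_block : ∀ B ∈ 𝓑, B.card = k
  card_blocks_through : ∀ T : Finset V, T.card = t → (𝓑.filter (fun B => T ⊆ B)).card = l

/-- The 01-vector `c_B` in `ℂ^V` of a set `B` of points. -/
def incidenceVector {V : Type*} [DecidableEq V] (B : Finset V) : V → ℂ :=
  fun i => if i ∈ B then 1 else 0

/-- The ideal `𝓘(𝓑)` of all polynomials that vanish at `c_B` for every block `B`. -/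
def blockIdeal {V : Type*} [DecidableEq V] (𝓑 : Finset (Finset V)) :
    Ideal (MvPolynomial V ℂ) :=
  MvPolynomial.vanishingIdeal ℂ {c : V → ℂ | ∃ B ∈ 𝓑, c = incidenceVector B}

/-- The set `𝓖₀`, consisting of `∑ x_i - k` and the polynomials `x_i ^ 2 - x_i`. -/
def trivialGenerators (V : Type*) [Fintype V] (k : ℕ) : Set (MvPolynomial V ℂ) :=
  {(∑ i : V, MvPolynomial.X i) - MvPolynomial.C (k : ℂ)} ∪
    {f | ∃ i : V, f = MvPolynomial.X i ^ 2 - MvPolynomial.X i}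

/-- The trivial ideal `𝓣`, generated by `𝓖₀`. -/
def trivialIdeal (V : Type*) [Fintype V] (k : ℕ) : Ideal (MvPolynomial V ℂ) :=
  Ideal.span (trivialGenerators V k)

/-- The smallest degree of a polynomial in `𝓘(𝓑)` that is not in `𝓣`, for a `k`-uniform `𝓑`. -/
def gamma₁ {V : Type*} [Fintype V] [DecidableEq V] (k : ℕ) (𝓑 : Finset (Finset V)) : ℕ :=
  sInf {d | ∃ f ∈ blockIdeal 𝓑, f ∉ trivialIdeal V k ∧ f.totalDegree = d}

/-- The smallest possible maximum degree `max {deg f | f ∈ 𝓖}` of a generating set `𝓖` of `𝓘(𝓑)`;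
generating sets whose degrees have no maximum do not take part. -/
def gamma₂ {V : Type*} [DecidableEq V] (𝓑 : Finset (Finset V)) : ℕ :=
  sInf {d | ∃ 𝓖 : Set (MvPolynomial V ℂ), Ideal.span 𝓖 = blockIdeal 𝓑 ∧
    IsGreatest (MvPolynomial.totalDegree '' 𝓖) d}

/-- The linear form `c_B · x`. -/
def blockForm {V : Type*} [Fintype V] [DecidableEq V] (B : Finset V) : MvPolynomial V ℂ :=
  ∑ i : V, MvPolynomial.C (incidenceVector B i) * MvPolynomial.X i

/-- The cubic `f_{B,i,j} = (x_i - x_j) (c_B · x - 2) (c_B · x - 4)`. -/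
def wittCubic {V : Type*} [Fintype V] [DecidableEq V] (B : Finset V) (i j : V) :
    MvPolynomial V ℂ :=
  (MvPolynomial.X i - MvPolynomial.X j) * (blockForm B - 2) * (blockForm B - 4)

end DesignIdeal

end

/-! An ideal containing every `X i ^ 2 - X i` is determined by its 01-zeros
(`mem_of_eval_incidenceVector`), so generation is a question about sets. Blocks meet in 0, 2, 4 or 8
points (`card_inter_witt`), which makes the cubics vanish on blocks. Conversely an 8-set `S` shares
at least 5 points with some block `B`; the cubics of `B` then force `B = S`. For the degrees, if `f`
vanishes on all blocks and has degree at most 2, then `|f|²` has degree at most 4, so its averages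
over blocks and over all 8-sets agree. The latter is thus 0, and `f` is trivial
(`mem_trivialIdeal`). Some cubic is not trivial, so 3 is attained. -/

namespace DesignIdeal

open MvPolynomial

/-! ### Ideals determined by their 01-zeros -/

section Indicator

variable {V : Type*} [Fintype V] [DecidableEq V]

/-- The polynomial that is `1` at the 01-vector of `S` and `0` at every other 01-vector. -/
noncomputable def indicatorPoly (S : Finset V) : MvPolynomial V ℂ :=
  (∏ i ∈ S, X i) * ∏ i ∈ Finset.univ \ S, (1 - X i)

theorem sum_indicatorPoly : ∑ S : Finset V, indicatorPoly S = 1 := by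
  have h := Finset.prod_add (fun i : V => (X i : MvPolynomial V ℂ)) (fun i => 1 - X i) Finset.univ
  simp only [add_sub_cancel, Finset.prod_const_one, Finset.powerset_univ] at h
  exact h.symm

theorem X_sub_C_mul_indicatorPoly_mem {J : Ideal (MvPolynomial V ℂ)}
    (hJ : ∀ i, X i ^ 2 - X i ∈ J) (S : Finset V) (i : V) :
    (X i - C (incidenceVector S i)) * indicatorPoly S ∈ J := by
  unfold indicatorPoly incidenceVector
  by_cases hi : i ∈ S
  · rw [← Finset.mul_prod_erase S _ hi, if_pos hi, C_1]
    convert J.mul_mem_left ((∏ j ∈ S.erase i, X j) * ∏ j ∈ Finset.univ \ S, (1 - X j)) (hJ i) using 1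
    ring
  · have hi' : i ∈ Finset.univ \ S := by simp [hi]
    rw [← Finset.mul_prod_erase _ (fun j => (1 - X j : MvPolynomial V ℂ)) hi', if_neg hi, C_0]
    convert J.mul_mem_left
      (-((∏ j ∈ S, X j) * ∏ j ∈ (Finset.univ \ S).erase i, (1 - X j))) (hJ i) using 1
    ring

/-- Modulo `J`, each variable acts on `indicatorPoly S` as a scalar, hence so does every polynomial.
-/
theorem mul_indicatorPoly_sub_mem {J : Ideal (MvPolynomial V ℂ)}
    (hJ : ∀ i, X i ^ 2 - X i ∈ J) (S : Finset V) (f : MvPolynomial V ℂ) :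
    f * indicatorPoly S - C (eval (incidenceVector S) f) * indicatorPoly S ∈ J := by
  induction f using MvPolynomial.induction_on with
  | C a => simp
  | add p q hp hq =>
    have := J.add_mem hp hq
    rw [map_add, C_add]
    convert this using 1
    ring
  | mul_X p i hp =>
    have := J.add_mem (J.mul_mem_left (X i) hp) (J.mul_mem_left
      (C (eval (incidenceVector S) p)) (X_sub_C_mul_indicatorPoly_mem hJ S i))
    rw [map_mul, eval_X, C_mul]
    convert this using 1
    ring

/-- An ideal containing all `x_i ^ 2 - x_i` is the vanishing ideal of its 01-zeros. -/
theorem mem_of_eval_incidenceVector {J : Ideal (MvPolynomial V ℂ)}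
    (hJ : ∀ i, X i ^ 2 - X i ∈ J) {f : MvPolynomial V ℂ}
    (hf : ∀ S : Finset V, (∀ g ∈ J, eval (incidenceVector S) g = 0) →
      eval (incidenceVector S) f = 0) : f ∈ J := by
  rw [← mul_one f, ← sum_indicatorPoly, Finset.mul_sum]
  refine J.sum_mem fun S _ => ?_
  have hS := mul_indicatorPoly_sub_mem hJ S f
  by_cases hz : ∀ g ∈ J, eval (incidenceVector S) g = 0
  · simpa [hf S hz] using hS
  -- If `g ∈ J` is nonzero at `S`, then `g * indicatorPoly S` is a unit multiple of `indicatorPoly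
  -- S` modulo `J`, so `indicatorPoly S ∈ J`.
  · push Not at hz
    obtain ⟨g, hg, hg0⟩ := hz
    refine J.mul_mem_left _ ?_
    have h := J.sub_mem (J.mul_mem_right (indicatorPoly S) hg) (mul_indicatorPoly_sub_mem hJ S g)
    rw [sub_sub_cancel] at h
    have h' := J.mul_mem_left (C (eval (incidenceVector S) g)⁻¹) h
    rwa [← mul_assoc, ← C_mul, inv_mul_cancel₀ hg0, C_1, one_mul] at h'

end Indicator

theorem totalDegree_trivialGenerators {V : Type*} [Fintype V] {k : ℕ}
    {f : MvPolynomial V ℂ} (hf : f ∈ trivialGenerators V k) : f.totalDegree ≤ 2 := by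
  rcases hf with rfl | ⟨i, rfl⟩
  · refine (totalDegree_sub_C_le _ _).trans (totalDegree_finsetSum_le fun i _ => ?_)
    simp
  · refine (totalDegree_sub _ _).trans ?_
    simp

/-! ### Evaluation at 01-vectors -/

section Ideals

variable {V : Type*} [DecidableEq V]

theorem mem_blockIdeal {𝓑 : Finset (Finset V)} {f : MvPolynomial V ℂ} :
    f ∈ blockIdeal 𝓑 ↔ ∀ B ∈ 𝓑, eval (incidenceVector B) f = 0 := by
  unfold blockIdeal
  rw [mem_vanishingIdeal_iff]
  constructor
  · intro h B hB
    simpa [aeval_eq_eval] using h _ ⟨B, hB, rfl⟩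
  · rintro h _ ⟨B, hB, rfl⟩
    simpa [aeval_eq_eval] using h B hB

theorem prod_incidenceVector_pow (B : Finset V) (d : V →₀ ℕ) :
    ∏ i ∈ d.support, incidenceVector B i ^ d i = if d.support ⊆ B then 1 else 0 := by
  split_ifs with h
  · refine Finset.prod_eq_one fun i hi => ?_
    simp [incidenceVector, h hi]
  · obtain ⟨i, hi, hiB⟩ := Finset.not_subset.1 h
    refine Finset.prod_eq_zero hi ?_
    simp [incidenceVector, hiB, Finsupp.mem_support_iff.1 hi]

theorem sum_eval_incidenceVector (𝓑 : Finset (Finset V)) (f : MvPolynomial V ℂ) :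
    ∑ B ∈ 𝓑, eval (incidenceVector B) f =
      ∑ d ∈ f.support, f.coeff d * (𝓑.filter (d.support ⊆ ·)).card := by
  simp only [eval_eq, prod_incidenceVector_pow]
  rw [Finset.sum_comm]
  refine Finset.sum_congr rfl fun d _ => ?_
  rw [← Finset.mul_sum, Finset.sum_boole]

theorem eval_incidenceVector_map_conj (S : Finset V) (f : MvPolynomial V ℂ) :
    eval (incidenceVector S) (map (starRingEnd ℂ) f) =
      starRingEnd ℂ (eval (incidenceVector S) f) := by
  rw [map_eval]
  congr 2
  ext i
  by_cases hi : i ∈ S <;> simp [incidenceVector, hi]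

/-- Double counting of pairs `T ⊆ B ∩ B'`; it gives the binomial moments of the intersection sizes.
-/
theorem sum_choose_card_inter (𝓑 : Finset (Finset V)) (B : Finset V) (j : ℕ) :
    ∑ B' ∈ 𝓑, (B ∩ B').card.choose j =
      ∑ T ∈ B.powersetCard j, (𝓑.filter (T ⊆ ·)).card := by
  have key := Finset.sum_card_bipartiteAbove_eq_sum_card_bipartiteBelow
    (s := B.powersetCard j) (t := 𝓑) (fun T B' => T ⊆ B')
  refine Eq.trans (Finset.sum_congr rfl fun B' _ => ?_) key.symm
  rw [← Finset.card_powersetCard]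
  congr 1
  ext T
  simp only [Finset.mem_powersetCard, Finset.mem_bipartiteBelow, Finset.subset_inter_iff]
  tauto

variable [Fintype V]

theorem sum_incidenceVector (S : Finset V) : ∑ i, incidenceVector S i = S.card := by
  simp [incidenceVector]

theorem eval_blockForm (B S : Finset V) :
    eval (incidenceVector S) (blockForm B) = (B ∩ S).card := by
  simp [blockForm, incidenceVector, Finset.inter_comm]

theorem eval_wittCubic (B S : Finset V) (i j : V) :
    eval (incidenceVector S) (wittCubic B i j) =
      (incidenceVector S i - incidenceVector S j) * ((B ∩ S).card - 2) * ((B ∩ S).card - 4) := by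
  simp [wittCubic, eval_blockForm]

theorem eval_trivialGenerators {k : ℕ} {S : Finset V} (hS : S.card = k) {f : MvPolynomial V ℂ}
    (hf : f ∈ trivialGenerators V k) : eval (incidenceVector S) f = 0 := by
  rcases hf with rfl | ⟨i, rfl⟩
  · simp [sum_incidenceVector, hS]
  · by_cases hi : i ∈ S <;> simp [incidenceVector, hi]

theorem card_eq_of_eval_trivialGenerators {k : ℕ} {S : Finset V}
    (h : ∀ f ∈ trivialGenerators V k, eval (incidenceVector S) f = 0) : S.card = k := by
  have := h _ (Or.inl rfl)
  simpa [sum_incidenceVector, sub_eq_zero] using this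

theorem eval_eq_zero_of_mem_trivialIdeal {k : ℕ} {S : Finset V} (hS : S.card = k)
    {f : MvPolynomial V ℂ} (hf : f ∈ trivialIdeal V k) : eval (incidenceVector S) f = 0 := by
  have : trivialIdeal V k ≤ RingHom.ker (eval (incidenceVector S)) :=
    Ideal.span_le.2 fun g hg => eval_trivialGenerators hS hg
  exact this hf

theorem mem_trivialIdeal_of_eval {k : ℕ} {f : MvPolynomial V ℂ}
    (hf : ∀ S : Finset V, S.card = k → eval (incidenceVector S) f = 0) : f ∈ trivialIdeal V k :=
  mem_of_eval_incidenceVector (fun i => Ideal.subset_span (Or.inr ⟨i, rfl⟩)) fun S hS =>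
    hf S (card_eq_of_eval_trivialGenerators fun g hg => hS g (Ideal.subset_span hg))

theorem totalDegree_blockForm_sub (B : Finset V) (a : ℂ) :
    (blockForm B - C a).totalDegree ≤ 1 := by
  refine (totalDegree_sub_C_le _ _).trans (totalDegree_finsetSum_le fun i _ => ?_)
  refine (totalDegree_mul _ _).trans ?_
  simp

theorem totalDegree_wittCubic (B : Finset V) (i j : V) : (wittCubic B i j).totalDegree ≤ 3 := by
  have h1 : (X i - X j : MvPolynomial V ℂ).totalDegree ≤ 1 :=
    (totalDegree_sub _ _).trans (by simp)
  have h2 := totalDegree_blockForm_sub B 2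
  have h4 := totalDegree_blockForm_sub B 4
  refine (totalDegree_mul _ _).trans ?_
  have := totalDegree_mul (X i - X j) (blockForm B - C 2)
  exact (add_le_add (this.trans (add_le_add h1 h2)) h4)

end Ideals

/-! ### Designs and averages of polynomials of low degree -/

section Design

variable {V : Type*} [Fintype V] [DecidableEq V] {t v k l m : ℕ} {𝓑 𝓒 : Finset (Finset V)}

/-- Double counting of pairs `(x, B)` with `T ⊆ B` and `x ∈ B \ T`. -/
theorem sub_mul_card_filter_subset (h : ∀ B ∈ 𝓑, B.card = k) (T : Finset V) :
    (k - T.card) * (𝓑.filter (T ⊆ ·)).card =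
      ∑ x ∈ Finset.univ \ T, (𝓑.filter (insert x T ⊆ ·)).card := by
  have key := Finset.sum_card_bipartiteAbove_eq_sum_card_bipartiteBelow
    (s := Finset.univ \ T) (t := 𝓑.filter (T ⊆ ·)) (fun x B => x ∈ B)
  have h1 : ∀ x ∈ Finset.univ \ T, (Finset.bipartiteAbove (fun x B => x ∈ B)
      (𝓑.filter (T ⊆ ·)) x).card = (𝓑.filter (insert x T ⊆ ·)).card := by
    intro x _
    congr 1
    ext B
    simp only [Finset.mem_bipartiteAbove, Finset.mem_filter, Finset.insert_subset_iff]
    tauto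
  have h2 : ∀ B ∈ 𝓑.filter (T ⊆ ·), (Finset.bipartiteBelow (fun x B => x ∈ B)
      (Finset.univ \ T) B).card = k - T.card := by
    intro B hB
    rw [Finset.mem_filter] at hB
    rw [← h B hB.1, ← Finset.card_sdiff_of_subset hB.2]
    congr 1
    ext x
    simp [Finset.mem_bipartiteBelow, and_comm]
  rw [Finset.sum_congr rfl h1, Finset.sum_congr rfl h2, Finset.sum_const, smul_eq_mul] at key
  rw [key, mul_comm]

/-- For sets of at most `t` points, the numbers of blocks through them in two `t`-designs with the
same `v` and `k` are proportional. -/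
theorem IsDesign.card_filter_subset_mul (h𝓑 : IsDesign t v k l 𝓑) (h𝓒 : IsDesign t v k m 𝓒)
    (htk : t ≤ k) {T : Finset V} (hT : T.card ≤ t) :
    m * (𝓑.filter (T ⊆ ·)).card = l * (𝓒.filter (T ⊆ ·)).card := by
  -- Downward induction on the size of `T`, starting from `t`.
  induction h : t - T.card generalizing T with
  | zero =>
    have hT' : T.card = t := by omega
    rw [h𝓑.card_blocks_through T hT', h𝓒.card_blocks_through T hT', mul_comm]
  | succ n ih =>
    have hpos : 0 < k - T.card := by omega
    refine Nat.eq_of_mul_eq_mul_left hpos ?_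
    rw [mul_left_comm, sub_mul_card_filter_subset h𝓑.card_block, mul_left_comm,
      sub_mul_card_filter_subset h𝓒.card_block, Finset.mul_sum, Finset.mul_sum]
    refine Finset.sum_congr rfl fun x hx => ?_
    have hx' : x ∉ T := by simpa using hx
    have hc := Finset.card_insert_of_notMem hx'
    exact ih (by omega) (by omega)

theorem card_filter_subset_powersetCard {T : Finset V} (hT : T.card ≤ k) :
    ((Finset.univ.powersetCard k).filter (T ⊆ ·)).card =
      (Fintype.card V - T.card).choose (k - T.card) := by
  rw [← Finset.card_compl, ← Finset.card_powersetCard]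
  refine Finset.card_bij' (fun S _ => S \ T) (fun S _ => S ∪ T) ?_ ?_ ?_ ?_
  · intro S hS
    simp only [Finset.mem_filter, Finset.mem_powersetCard] at hS ⊢
    refine ⟨fun x hx => by simp_all, ?_⟩
    rw [Finset.card_sdiff_of_subset hS.2, hS.1.2]
  · intro S hS
    simp only [Finset.mem_filter, Finset.mem_powersetCard] at hS ⊢
    refine ⟨⟨Finset.subset_univ _, ?_⟩, Finset.subset_union_right⟩
    rw [Finset.card_union_of_disjoint
      (Finset.disjoint_left.2 fun x hx => Finset.mem_compl.1 (hS.1 hx)), hS.2]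
    omega
  · intro S hS
    exact Finset.sdiff_union_of_subset (Finset.mem_filter.1 hS).2
  · intro S hS
    rw [Finset.mem_powersetCard] at hS
    exact Finset.union_sdiff_cancel_right
      (Finset.disjoint_left.2 fun x hx => Finset.mem_compl.1 (hS.1 hx))

theorem isDesign_powersetCard (hv : Fintype.card V = v) (htk : t ≤ k) :
    IsDesign t v k ((v - t).choose (k - t)) (Finset.univ.powersetCard k : Finset (Finset V)) where
  card_points := hv
  card_block _ hB := (Finset.mem_powersetCard.1 hB).2
  card_blocks_through T hT := by
    rw [card_filter_subset_powersetCard (hT.trans_le htk), hv, hT]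

/-- Polynomials of degree at most `t` have proportional sums over two `t`-designs. -/
theorem IsDesign.mul_sum_eval (h𝓑 : IsDesign t v k l 𝓑) (h𝓒 : IsDesign t v k m 𝓒)
    (htk : t ≤ k) {f : MvPolynomial V ℂ} (hf : f.totalDegree ≤ t) :
    m * ∑ B ∈ 𝓑, eval (incidenceVector B) f = l * ∑ B ∈ 𝓒, eval (incidenceVector B) f := by
  simp only [sum_eval_incidenceVector, Finset.mul_sum]
  refine Finset.sum_congr rfl fun d hd => ?_
  have hdt : d.support.card ≤ t := by
    refine le_trans ?_ ((le_totalDegree hd).trans hf)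
    rw [Finset.card_eq_sum_ones, Finsupp.sum]
    exact Finset.sum_le_sum fun i hi => Nat.one_le_iff_ne_zero.2 (Finsupp.mem_support_iff.1 hi)
  have := congrArg (Nat.cast : ℕ → ℂ) (h𝓑.card_filter_subset_mul h𝓒 htk hdt)
  push_cast at this
  rw [mul_left_comm, this, mul_left_comm]

/-- A polynomial of degree at most `t / 2` that vanishes on a `t`-design is trivial. -/
theorem IsDesign.mem_trivialIdeal (h𝓑 : IsDesign t v k l 𝓑) (hl : l ≠ 0) (htk : t ≤ k)
    {f : MvPolynomial V ℂ} (hf : f ∈ blockIdeal 𝓑) (hdeg : 2 * f.totalDegree ≤ t) :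
    f ∈ trivialIdeal V k := by
  -- 01-vectors are real, so this product takes the value `|f|²` there.
  have hg : (f * map (starRingEnd ℂ) f).totalDegree ≤ t := by
    have h1 := totalDegree_mul f (map (starRingEnd ℂ) f)
    have h2 : (map (starRingEnd ℂ) f).totalDegree ≤ f.totalDegree :=
      Finset.sup_mono (support_map_subset _ _)
    omega
  have hsum := h𝓑.mul_sum_eval (isDesign_powersetCard h𝓑.card_points htk) htk hg
  have heval : ∀ S : Finset V, eval (incidenceVector S) (f * map (starRingEnd ℂ) f) =
      ((Complex.normSq (eval (incidenceVector S) f) : ℝ) : ℂ) := by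
    intro S
    rw [map_mul, eval_incidenceVector_map_conj, Complex.mul_conj]
  simp only [heval] at hsum
  rw [Finset.sum_eq_zero fun B hB => by rw [mem_blockIdeal.1 hf B hB]; simp, mul_zero, eq_comm,
    mul_eq_zero, or_iff_right (Nat.cast_ne_zero.2 hl), ← Complex.ofReal_sum,
    Complex.ofReal_eq_zero, Finset.sum_eq_zero_iff_of_nonneg fun _ _ => Complex.normSq_nonneg _]
    at hsum
  refine mem_trivialIdeal_of_eval fun S hS => ?_
  exact Complex.normSq_eq_zero.1 (hsum S (by simp [hS]))

end Design

/-! ### The large Witt design -/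

section Witt

variable {V : Type*} [Fintype V] [DecidableEq V] {𝓑 : Finset (Finset V)}

theorem IsDesign.exists_block (h𝓑 : IsDesign 5 24 8 1 𝓑) {S : Finset V} (hS : 5 ≤ S.card) :
    ∃ B ∈ 𝓑, 5 ≤ (B ∩ S).card := by
  obtain ⟨T, hTS, hT⟩ := Finset.exists_subset_card_eq hS
  obtain ⟨B, hB⟩ := Finset.card_pos.1 ((h𝓑.card_blocks_through T hT).symm ▸ Nat.one_pos)
  rw [Finset.mem_filter] at hB
  exact ⟨B, hB.1, hT ▸ Finset.card_le_card (Finset.subset_inter hB.2 hTS)⟩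

theorem IsDesign.card_inter_le_four (h𝓑 : IsDesign 5 24 8 1 𝓑) {B B' : Finset V} (hB : B ∈ 𝓑)
    (hB' : B' ∈ 𝓑) (hne : B ≠ B') : (B ∩ B').card ≤ 4 := by
  by_contra! h
  obtain ⟨T, hTS, hT⟩ := Finset.exists_subset_card_eq (Nat.succ_le_of_lt h)
  rw [Finset.subset_inter_iff] at hTS
  exact hne (Finset.card_le_one.1 (h𝓑.card_blocks_through T hT).le B (by simp [hB, hTS]) B'
    (by simp [hB', hTS]))

/-- Comparison with the design of all 8-sets, where 969 = C(19, 3) sets contain a given 5-set. -/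
theorem IsDesign.card_filter_subset_witt (h𝓑 : IsDesign 5 24 8 1 𝓑) {T : Finset V}
    (hT : T.card ≤ 5) :
    969 * (𝓑.filter (T ⊆ ·)).card = (24 - T.card).choose (8 - T.card) := by
  have h := h𝓑.card_filter_subset_mul (isDesign_powersetCard h𝓑.card_points (by norm_num))
    (by norm_num) hT
  rw [card_filter_subset_powersetCard (by omega), h𝓑.card_points, one_mul] at h
  exact h

theorem IsDesign.mul_sum_choose_card_inter (h𝓑 : IsDesign 5 24 8 1 𝓑) {B : Finset V}
    (hB : B ∈ 𝓑) {j : ℕ} (hj : j ≤ 5) :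
    969 * ∑ B' ∈ 𝓑, (B ∩ B').card.choose j = Nat.choose 8 j * (24 - j).choose (8 - j) := by
  rw [sum_choose_card_inter, Finset.mul_sum, Finset.sum_congr rfl fun T hT => by
    rw [h𝓑.card_filter_subset_witt ((Finset.mem_powersetCard.1 hT).2.trans_le hj),
      (Finset.mem_powersetCard.1 hT).2], Finset.sum_const, Finset.card_powersetCard,
    h𝓑.card_block B hB, smul_eq_mul]

/-- Two blocks of the Witt design meet in `0`, `2`, `4` or `8` points. The values at `s ≤ 4` of the
polynomial `s (s - 2) ^ 2 (s - 4)`, written here in the binomial basis, are not positive, and its sum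
over all blocks is its value at `s = 8`. -/
theorem IsDesign.card_inter_witt (h𝓑 : IsDesign 5 24 8 1 𝓑) {B B' : Finset V} (hB : B ∈ 𝓑)
    (hB' : B' ∈ 𝓑) (hne : B ≠ B') :
    (B ∩ B').card = 0 ∨ (B ∩ B').card = 2 ∨ (B ∩ B').card = 4 := by
  set q : ℕ → ℤ := fun s =>
    -3 * (s.choose 1 : ℤ) + 6 * s.choose 2 - 12 * s.choose 3 + 24 * s.choose 4 with hq
  have hsum : ∑ B' ∈ 𝓑, q (B ∩ B').card = 1152 := by
    -- The moments are C(8, j) times the number of blocks through `j` points: 8·253, 28·77, 56·21,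
    -- 70·5.
    have h1 : 969 * ∑ B' ∈ 𝓑, (B ∩ B').card.choose 1 = 969 * 2024 :=
      h𝓑.mul_sum_choose_card_inter hB (by norm_num)
    have h2 : 969 * ∑ B' ∈ 𝓑, (B ∩ B').card.choose 2 = 969 * 2156 :=
      h𝓑.mul_sum_choose_card_inter hB (by norm_num)
    have h3 : 969 * ∑ B' ∈ 𝓑, (B ∩ B').card.choose 3 = 969 * 1176 :=
      h𝓑.mul_sum_choose_card_inter hB (by norm_num)
    have h4 : 969 * ∑ B' ∈ 𝓑, (B ∩ B').card.choose 4 = 969 * 350 :=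
      h𝓑.mul_sum_choose_card_inter hB (by norm_num)
    simp only [hq, Finset.sum_add_distrib, Finset.sum_sub_distrib, ← Finset.mul_sum,
      ← Nat.cast_sum]
    omega
  rw [← Finset.add_sum_erase _ _ hB, Finset.inter_self, h𝓑.card_block B hB] at hsum
  have hq8 : q 8 = 1152 := by decide
  have hle : ∀ s ≤ 4, q s ≤ 0 := by decide
  have hzero : ∑ B' ∈ 𝓑.erase B, q (B ∩ B').card = 0 := by omega
  rw [Finset.sum_eq_zero_iff_of_nonpos fun C hC => hle _ (h𝓑.card_inter_le_four hB
    (Finset.mem_of_mem_erase hC) (Finset.ne_of_mem_erase hC).symm)] at hzero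
  have h0 := hzero B' (Finset.mem_erase.2 ⟨hne.symm, hB'⟩)
  have h4 := h𝓑.card_inter_le_four hB hB' hne
  have hroots : ∀ s ≤ 4, q s = 0 → s = 0 ∨ s = 2 ∨ s = 4 := by decide
  exact hroots _ h4 h0

theorem IsDesign.wittCubic_mem_blockIdeal (h𝓑 : IsDesign 5 24 8 1 𝓑) {B : Finset V} (hB : B ∈ 𝓑)
    {i j : V} (hi : i ∈ B) (hj : j ∈ B) : wittCubic B i j ∈ blockIdeal 𝓑 := by
  refine mem_blockIdeal.2 fun B' hB' => ?_
  rw [eval_wittCubic]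
  by_cases hne : B = B'
  · subst hne
    simp [incidenceVector, hi, hj]
  rcases h𝓑.card_inter_witt hB hB' hne with h | h | h
  · rw [Finset.card_eq_zero, ← Finset.disjoint_iff_inter_eq_empty] at h
    simp [incidenceVector, Finset.disjoint_left.1 h hi, Finset.disjoint_left.1 h hj]
  · simp [h]
  · simp [h]

theorem IsDesign.mem_of_eval_wittCubic (h𝓑 : IsDesign 5 24 8 1 𝓑) {S : Finset V}
    (hS : S.card = 8)
    (h : ∀ B ∈ 𝓑, ∀ i ∈ B, ∀ j ∈ B, eval (incidenceVector S) (wittCubic B i j) = 0) :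
    S ∈ 𝓑 := by
  obtain ⟨B, hB, hBS⟩ := h𝓑.exists_block (S := S) (by omega)
  -- As `|B ∩ S| ≥ 5`, both quadratic factors are nonzero, so membership in `S` is constant on `B`.
  have hsub : B ⊆ S := by
    intro j hj
    by_contra hjS
    obtain ⟨i, hi⟩ := Finset.card_pos.1 (by omega : 0 < (B ∩ S).card)
    rw [Finset.mem_inter] at hi
    have h0 := h B hB i hi.1 j hj
    rw [eval_wittCubic, mul_eq_zero, mul_eq_zero, sub_eq_zero, sub_eq_zero, sub_eq_zero] at h0
    rcases h0 with (h0 | h0) | h0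
    · simp [incidenceVector, hi.2, hjS] at h0
    · have : (B ∩ S).card = 2 := by exact_mod_cast h0
      omega
    · have : (B ∩ S).card = 4 := by exact_mod_cast h0
      omega
  rwa [← Finset.eq_of_subset_of_card_le hsub (by rw [hS, h𝓑.card_block B hB])]

/-- The generating set of the block ideal of the Witt design. -/
def wittGenerators (𝓑 : Finset (Finset V)) : Set (MvPolynomial V ℂ) :=
  trivialGenerators V 8 ∪ {f | ∃ B ∈ 𝓑, ∃ i ∈ B, ∃ j ∈ B, f = wittCubic B i j}

theorem IsDesign.blockIdeal_eq_span (h𝓑 : IsDesign 5 24 8 1 𝓑) :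
    blockIdeal 𝓑 = Ideal.span (wittGenerators 𝓑) := by
  refine le_antisymm (fun f hf => ?_) (Ideal.span_le.2 ?_)
  · refine mem_of_eval_incidenceVector
      (fun i => Ideal.subset_span (Or.inl (Or.inr ⟨i, rfl⟩))) fun S hS => ?_
    refine mem_blockIdeal.1 hf S (h𝓑.mem_of_eval_wittCubic ?_ ?_)
    · exact card_eq_of_eval_trivialGenerators fun g hg => hS g (Ideal.subset_span (Or.inl hg))
    · exact fun B hB i hi j hj => hS _ (Ideal.subset_span (Or.inr ⟨B, hB, i, hi, j, hj, rfl⟩))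
  · rintro f (hf | ⟨B, hB, i, hi, j, hj, rfl⟩)
    · exact mem_blockIdeal.2 fun B hB => eval_trivialGenerators (h𝓑.card_block B hB) hf
    · exact h𝓑.wittCubic_mem_blockIdeal hB hi hj

theorem IsDesign.three_le_totalDegree (h𝓑 : IsDesign 5 24 8 1 𝓑) {f : MvPolynomial V ℂ}
    (hf : f ∈ blockIdeal 𝓑) (hfT : f ∉ trivialIdeal V 8) : 3 ≤ f.totalDegree := by
  by_contra! h
  exact hfT (h𝓑.mem_trivialIdeal one_ne_zero (by norm_num) hf (by omega))

theorem IsDesign.exists_wittCubic_notMem (h𝓑 : IsDesign 5 24 8 1 𝓑) :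
    ∃ B ∈ 𝓑, ∃ i ∈ B, ∃ j ∈ B, wittCubic B i j ∉ trivialIdeal V 8 := by
  obtain ⟨B, hB, -⟩ := h𝓑.exists_block (S := Finset.univ)
    (by rw [Finset.card_univ, h𝓑.card_points]; norm_num)
  have hB8 := h𝓑.card_block B hB
  obtain ⟨i, hi, j, hj, hij⟩ := Finset.one_lt_card.1 (by omega : 1 < B.card)
  -- The 8-set `insert i U` meets `B` only in `i`, so the cubic takes the value (1 - 2)(1 - 4) = 3
  -- there.
  obtain ⟨U, hU, hU7⟩ := Finset.exists_subset_card_eq (s := Bᶜ) (n := 7)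
    (by rw [Finset.card_compl, h𝓑.card_points, hB8]; norm_num)
  have hUB : ∀ x ∈ B, x ∉ U := fun x hx hxU => Finset.mem_compl.1 (hU hxU) hx
  refine ⟨B, hB, i, hi, j, hj, fun h => ?_⟩
  have hS : (insert i U).card = 8 := by rw [Finset.card_insert_of_notMem (hUB i hi), hU7]
  have h0 := eval_eq_zero_of_mem_trivialIdeal hS h
  have hinter : B ∩ insert i U = {i} := by
    ext x
    simp only [Finset.mem_inter, Finset.mem_insert, Finset.mem_singleton]
    exact ⟨fun hx => hx.2.resolve_right (hUB x hx.1), fun hx => ⟨hx ▸ hi, Or.inl hx⟩⟩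
  rw [eval_wittCubic, hinter] at h0
  simp [incidenceVector, hij.symm, hUB j hj] at h0
  norm_num at h0

theorem IsDesign.gamma₁_witt (h𝓑 : IsDesign 5 24 8 1 𝓑) : gamma₁ 8 𝓑 = 3 := by
  obtain ⟨B, hB, i, hi, j, hj, hT⟩ := h𝓑.exists_wittCubic_notMem
  have hI := h𝓑.wittCubic_mem_blockIdeal hB hi hj
  refine IsLeast.csInf_eq ⟨⟨_, hI, hT, ?_⟩, ?_⟩
  · exact (totalDegree_wittCubic B i j).antisymm (h𝓑.three_le_totalDegree hI hT)
  · rintro _ ⟨f, hf, hfT, rfl⟩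
    exact h𝓑.three_le_totalDegree hf hfT

theorem IsDesign.gamma₂_witt (h𝓑 : IsDesign 5 24 8 1 𝓑) : gamma₂ 𝓑 = 3 := by
  obtain ⟨B, hB, i, hi, j, hj, hT⟩ := h𝓑.exists_wittCubic_notMem
  have hI := h𝓑.wittCubic_mem_blockIdeal hB hi hj
  refine IsLeast.csInf_eq
    ⟨⟨wittGenerators 𝓑, h𝓑.blockIdeal_eq_span.symm, ⟨wittCubic B i j, ?_, ?_⟩, ?_⟩, ?_⟩
  · exact Or.inr ⟨B, hB, i, hi, j, hj, rfl⟩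
  · exact (totalDegree_wittCubic B i j).antisymm (h𝓑.three_le_totalDegree hI hT)
  · rintro _ ⟨f, hf | ⟨B', _, i', _, j', _, rfl⟩, rfl⟩
    · exact (totalDegree_trivialGenerators hf).trans (by norm_num)
    · exact totalDegree_wittCubic B' i' j'
  · rintro d ⟨𝓖, h𝓖, -, hd⟩
    by_contra! hlt
    -- Generators of degree below 3 are all trivial, so they cannot generate the nontrivial cubic.
    refine hT ((Ideal.span_le.2 fun g hg => ?_ : Ideal.span 𝓖 ≤ trivialIdeal V 8) (h𝓖 ▸ hI))
    by_contra hgT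
    have h3 := h𝓑.three_le_totalDegree (h𝓖 ▸ Ideal.subset_span hg) hgT
    have := hd ⟨g, hg, rfl⟩
    omega

end Witt

end DesignIdeal

theorem mainTheorem6 {V : Type*} [Fintype V] [DecidableEq V] (𝓑 : Finset (Finset V))
    (h𝓑 : DesignIdeal.IsDesign 5 24 8 1 𝓑) :
    DesignIdeal.blockIdeal 𝓑 =
        Ideal.span (DesignIdeal.trivialGenerators V 8 ∪
          {f | ∃ B ∈ 𝓑, ∃ i ∈ B, ∃ j ∈ B, f = DesignIdeal.wittCubic B i j}) ∧
      DesignIdeal.gamma₁ 8 𝓑 = 3 ∧ DesignIdeal.gamma₂ 𝓑 = 3 :=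
  ⟨h𝓑.blockIdeal_eq_span, h𝓑.gamma₁_witt, h𝓑.gamma₂_witt⟩
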